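/- Let $K$ be a field of characteristic zero; all algebras and Hopf algebras are over $K$. Let $\Gamma$ be a group with neutral element $e$ and $A$ a Hopf algebra with comultiplication $a\mapsto a_{(1)}\otimes a_{(2)}$ and counit $\varepsilon$. An invariant cocentral action of $\Gamma$ on $A$ is a pair $(p,\alpha)$, where $p\colon A\to K\Gamma$ is a Hopf algebra homomorphism to the group algebra with $p(a_{(1)})\otimes a_{(2)}=p(a_{(2)})\otimes a_{(1)}$ for all $a\in A$, and $\alpha\colon\Gamma\to\mathrm{Aut}(A)$ is an action by Hopf algebra automorphisms with $p\alpha_g=p$ for all $g\in\Gamma$. It defines a grading $A=\bigoplus_{g\in\Gamma}A_g$, where $A_g=\{a\in A\mid p(a_{(1)})\otimes a_{(2)}=g\otimes a\}$, and $A_e$ is a Hopf subalgebra of $A$. The graded twisting $A^{t,\alpha}$ is the Hopf algebra $\sum_{g\in\Gamma}A_g\otimes g\subset A\rtimes\Gamma$, with the algebra structure of the crossed product $A\rtimes\Gamma$, in which $(a\otimes g)(b\otimes h)=a\,\alpha_g(b)\otimes gh$, and with the coalgebra structure transported from $A$ by the linear isomorphism $j\colon A\to A^{t,\alpha}$, $\sum_g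 a_g\mapsto\sum_g a_g\otimes g$ $(a_g\in A_g)$. A Hopf ideal $I\subset A$ is $\Gamma$-graded if $I=\bigoplus_g(I\cap A_g)$ and $\Gamma$-stable if $\alpha_g(I)\subset I$ for all $g\in\Gamma$; for such $I$, the pair $(p,\alpha)$ induces an invariant cocentral action $(\overline p,\overline\alpha)$ of $\Gamma$ on $A/I$. A Hopf algebra quotient of a Hopf algebra $H$ is a Hopf algebra $L$ together with a surjective Hopf algebra homomorphism $H\to L$. **Theorem.** Suppose that $\Gamma$ is a cyclic group of prime order and that $A$ is a commutative Hopf algebra endowed with an invariant cocentral action $(p,\alpha)$ of $\Gamma$ such that $p\colon A\to K\Gamma$ is surjective. Then for any Hopf algebra quotient $L$ of $A^{t,\alpha}$ one of the following holds: (i) $L$ is commutative and isomorphic, as a Hopf algebra, to a Hopf algebra quotient of $A_e$; (ii) $L$ is isomorphic, as a Hopf algebra, to $(A/I)^{t,\overline\alpha}$ for some $\Gamma$-graded and $\Gamma$-stable Hopf ideal $I\subset A$. -/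

import Mathlib

open scoped TensorProduct

/-- The coalgebra structure on a retract `B` of a coalgebra `A`. -/
@[reducible]
noncomputable def retractCoalgebra {K A B : Type*} [Field K] [AddCommGroup A] [Module K A]
    [Coalgebra K A] [AddCommGroup B] [Module K B] (i : B →ₗ[K] A) (r : A →ₗ[K] B)
    (hri : ∀ b, r (i b) = b)
    (h : ∀ b, TensorProduct.map (i ∘ₗ r) (i ∘ₗ r) (Coalgebra.comul (R := K) (i b)) =
      Coalgebra.comul (i b)) : Coalgebra K B :=
  have hri' : r ∘ₗ i = LinearMap.id := LinearMap.ext hri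
  have hcomul : ∀ b, TensorProduct.map i i (TensorProduct.map r r (Coalgebra.comul (R := K) (i b)))
      = Coalgebra.comul (i b) := by
    intro b
    rw [← LinearMap.comp_apply, ← TensorProduct.map_comp, h]
  { comul := TensorProduct.map r r ∘ₗ Coalgebra.comul ∘ₗ i
    counit := Coalgebra.counit ∘ₗ i
    coassoc := by
      ext b
      have hinj : Function.Injective (TensorProduct.map i (TensorProduct.map i i)) := by
        apply Function.LeftInverse.injective (g := TensorProduct.map r (TensorProduct.map r r))
        intro t
        rw [← LinearMap.comp_apply, ← TensorProduct.map_comp, ← TensorProduct.map_comp, hri',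
          TensorProduct.map_id, TensorProduct.map_id, LinearMap.id_apply]
      apply hinj
      simp only [LinearMap.comp_apply, LinearEquiv.coe_coe]
      trans TensorProduct.assoc K A A A (Coalgebra.comul.rTensor A
        (TensorProduct.map i i (TensorProduct.map r r (Coalgebra.comul (R := K) (i b)))))
      · generalize TensorProduct.map r r (Coalgebra.comul (R := K) (i b)) = t
        induction t with
        | zero => simp
        | add x y hx hy => simp only [map_add, hx, hy]
        | tmul x y =>
          simp only [LinearMap.rTensor_tmul, TensorProduct.map_tmul, LinearMap.comp_apply]
          rw [← hcomul x]
          generalize TensorProduct.map r r (Coalgebra.comul (R := K) (i x)) = s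
          induction s with
          | zero => simp
          | add x y hx hy => simp only [map_add, TensorProduct.add_tmul, hx, hy]
          | tmul x z => simp [hri]
      · rw [hcomul, Coalgebra.coassoc_apply]
        conv_lhs => rw [← hcomul b]
        generalize TensorProduct.map r r (Coalgebra.comul (R := K) (i b)) = t
        induction t with
        | zero => simp
        | add x y hx hy => simp only [map_add, hx, hy]
        | tmul x y =>
          simp only [LinearMap.lTensor_tmul, TensorProduct.map_tmul, LinearMap.comp_apply, hcomul]
    rTensor_counit_comp_comul := by
      ext b
      have e := congrArg (TensorProduct.map (LinearMap.id : K →ₗ[K] K) r)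
        (Coalgebra.rTensor_counit_comul (R := K) (i b))
      rw [← hcomul b] at e
      simp only [LinearMap.comp_apply, TensorProduct.mk_apply]
      rw [TensorProduct.map_tmul, hri, LinearMap.id_apply] at e
      rw [← e]
      generalize TensorProduct.map r r (Coalgebra.comul (R := K) (i b)) = t
      induction t with
      | zero => simp
      | add x y hx hy => simp only [map_add, hx, hy]
      | tmul x y => simp [hri]
    lTensor_counit_comp_comul := by
      ext b
      have e := congrArg (TensorProduct.map r (LinearMap.id : K →ₗ[K] K))
        (Coalgebra.lTensor_counit_comul (R := K) (i b))
      rw [← hcomul b] at e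
      simp only [LinearMap.comp_apply, LinearMap.flip_apply, TensorProduct.mk_apply]
      rw [TensorProduct.map_tmul, hri, LinearMap.id_apply] at e
      rw [← e]
      generalize TensorProduct.map r r (Coalgebra.comul (R := K) (i b)) = t
      induction t with
      | zero => simp
      | add x y hx hy => simp only [map_add, hx, hy]
      | tmul x y => simp [hri] }

/-- An invariant cocentral action `(p, α)` of a group `Γ` on a Hopf algebra `A` over `K`: a cocentral
Hopf algebra homomorphism `p : A → KΓ`, that is `p(a₁) ⊗ a₂ = p(a₂) ⊗ a₁`, together with an action
`α` of `Γ` on `A` by Hopf algebra automorphisms such that `p ∘ α_g = p` for all `g`. A bialgebra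
homomorphism between Hopf algebras automatically commutes with the antipodes. -/
structure InvariantCocentralAction (K Γ A : Type*) [Field K] [Group Γ] [Ring A]
    [HopfAlgebra K A] where
  p : A →ₐc[K] MonoidAlgebra K Γ
  cocentral : ∀ a : A,
    TensorProduct.map (p : A →ₗ[K] MonoidAlgebra K Γ) LinearMap.id
        (Coalgebra.comul (R := K) a) =
      TensorProduct.map (p : A →ₗ[K] MonoidAlgebra K Γ) LinearMap.id
        (TensorProduct.comm K A A (Coalgebra.comul (R := K) a))
  act : Γ → (A ≃ₐc[K] A)
  act_one : ∀ a, act 1 a = a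
  act_mul : ∀ g h a, act (g * h) a = act g (act h a)
  p_act : ∀ g a, p (act g a) = p a

namespace InvariantCocentralAction
noncomputable section
open Coalgebra HopfAlgebra
/-- The coefficient at `g`, as a linear functional on the group algebra. -/
def coeffAt (K : Type*) {Γ : Type*} [Field K] (g : Γ) : MonoidAlgebra K Γ →ₗ[K] K :=
  Finsupp.lapply g ∘ₗ (MonoidAlgebra.coeffLinearEquiv K).toLinearMap

theorem coeffAt_single {K Γ : Type*} [Field K] [DecidableEq Γ] (g h : Γ) (r : K) :
    coeffAt K g (MonoidAlgebra.single h r) = if h = g then r else 0 := by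
  simp [coeffAt, Finsupp.single_apply]

variable {K Γ A : Type*} [Field K] [Group Γ] [Ring A] [HopfAlgebra K A]
variable (D : InvariantCocentralAction K Γ A)

/-- The homogeneous component `A_g = {a | p(a₁) ⊗ a₂ = g ⊗ a}`. -/
def component (g : Γ) : Submodule K A where
  carrier := {a | TensorProduct.map (D.p : A →ₗ[K] MonoidAlgebra K Γ) LinearMap.id
    (comul (R := K) a) = MonoidAlgebra.single g 1 ⊗ₜ[K] a}
  zero_mem' := by simp
  add_mem' := by
    intro a b ha hb
    simp only [Set.mem_ofPred_eq] at *
    rw [map_add, map_add, ha, hb, TensorProduct.tmul_add]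
  smul_mem' := by
    intro c a ha
    simp only [Set.mem_ofPred_eq] at *
    rw [map_smul, map_smul, ha, TensorProduct.tmul_smul]

/-- The `KΓ`-coaction `a ↦ a₁ ⊗ p(a₂)`. -/
def coact : A →ₐ[K] A ⊗[K] MonoidAlgebra K Γ :=
  (Algebra.TensorProduct.map (AlgHom.id K A) (D.p : A →ₐ[K] MonoidAlgebra K Γ)).comp
    (Bialgebra.comulAlgHom K A)

theorem coact_apply (a : A) : D.coact a =
    TensorProduct.map LinearMap.id (D.p : A →ₗ[K] MonoidAlgebra K Γ) (comul (R := K) a) := rfl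

theorem mem_component {g : Γ} {a : A} :
    a ∈ D.component g ↔ D.coact a = a ⊗ₜ[K] MonoidAlgebra.single g 1 := by
  have h1 : TensorProduct.comm K A (MonoidAlgebra K Γ) (D.coact a) =
      TensorProduct.map (D.p : A →ₗ[K] MonoidAlgebra K Γ) LinearMap.id
        (comul (R := K) a) := by
    rw [D.cocentral, coact_apply, TensorProduct.map_comm]
  constructor
  · intro h
    have h2 : TensorProduct.map (D.p : A →ₗ[K] MonoidAlgebra K Γ) LinearMap.id
      (comul (R := K) a) = MonoidAlgebra.single g 1 ⊗ₜ[K] a := h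
    apply (TensorProduct.comm K A (MonoidAlgebra K Γ)).injective
    rw [h1, h2, TensorProduct.comm_tmul]
  · intro h
    change TensorProduct.map (D.p : A →ₗ[K] MonoidAlgebra K Γ) LinearMap.id
      (comul (R := K) a) = MonoidAlgebra.single g 1 ⊗ₜ[K] a
    rw [← h1, h, TensorProduct.comm_tmul]

theorem one_mem_component : (1 : A) ∈ D.component 1 := by
  rw [mem_component, map_one]; rfl

theorem mul_mem_component {g h : Γ} {a b : A} (ha : a ∈ D.component g) (hb : b ∈ D.component h) :
    a * b ∈ D.component (g * h) := by
  rw [mem_component] at *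
  rw [map_mul, ha, hb, Algebra.TensorProduct.tmul_mul_tmul, MonoidAlgebra.single_mul_single,
    mul_one]

theorem act_mem_component {g h : Γ} {a : A} (ha : a ∈ D.component h) :
    D.act g a ∈ D.component h := by
  rw [mem_component] at *
  have h1 : TensorProduct.map (D.act g : A →ₗ[K] A) LinearMap.id (D.coact a) =
    D.coact (D.act g a) := by
    rw [coact_apply, coact_apply, ← CoalgHomClass.map_comp_comul_apply (D.act g) a]
    generalize comul (R := K) a = t
    induction t with
    | zero => simp
    | add x y hx hy => simp only [map_add, hx, hy]
    | tmul x y =>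
      simp only [TensorProduct.map_tmul]
      exact congrArg (fun z => D.act g x ⊗ₜ[K] z) (D.p_act g y).symm
  rw [← h1, ha]; rfl

/-- The projection onto the homogeneous component. -/
def proj (g : Γ) : A →ₗ[K] A :=
  (TensorProduct.rid K A).toLinearMap ∘ₗ
    TensorProduct.map LinearMap.id (coeffAt K g) ∘ₗ D.coact.toLinearMap

theorem coact_coassoc (a : A) :
    TensorProduct.assoc K _ _ _ (TensorProduct.map D.coact.toLinearMap LinearMap.id (D.coact a)) =
    TensorProduct.map LinearMap.id (comul (R := K)) (D.coact a) := by
  have hp : (comul (R := K)) ∘ₗ (D.p : A →ₗ[K] MonoidAlgebra K Γ) =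
    TensorProduct.map (D.p : A →ₗ[K] MonoidAlgebra K Γ) (D.p : A →ₗ[K] MonoidAlgebra K Γ) ∘ₗ comul :=
    (CoalgHomClass.map_comp_comul D.p).symm
  rw [coact_apply, ← LinearMap.comp_apply (TensorProduct.map LinearMap.id comul),
    ← TensorProduct.map_comp, hp, LinearMap.id_comp]
  have h0 := Coalgebra.coassoc_apply (R := K) a
  have h1 := congrArg (TensorProduct.map (LinearMap.id : A →ₗ[K] A) 
    (TensorProduct.map (D.p : A →ₗ[K] MonoidAlgebra K Γ) (D.p : A →ₗ[K] MonoidAlgebra K Γ))) h0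
  rw [LinearMap.lTensor, ← LinearMap.comp_apply (TensorProduct.map _ _),
    ← TensorProduct.map_comp, LinearMap.id_comp] at h1
  rw [← h1]
  generalize comul (R := K) a = t
  induction t with
  | zero => simp
  | add x y hx hy => simp only [map_add, hx, hy]
  | tmul x y =>
    simp only [TensorProduct.map_tmul, LinearMap.id_apply, AlgHom.toLinearMap_apply, coact_apply,
      LinearMap.rTensor_tmul]
    generalize comul (R := K) x = s
    induction s with
    | zero => simp
    | add x y hx hy => simp only [map_add, TensorProduct.add_tmul, hx, hy]
    | tmul x z => rfl

theorem proj_mem (g : Γ) (a : A) : D.proj g a ∈ D.component g := by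
  classical
  rw [mem_component]
  have h := congrArg (TensorProduct.map (LinearMap.id : A →ₗ[K] A) 
    ((TensorProduct.rid K (MonoidAlgebra K Γ)).toLinearMap ∘ₗ 
      TensorProduct.map (LinearMap.id) (coeffAt K g))) (D.coact_coassoc a)
  have h1 : ((TensorProduct.rid K (MonoidAlgebra K Γ)).toLinearMap ∘ₗ 
      TensorProduct.map (LinearMap.id) (coeffAt K g)) ∘ₗ comul = 
      (LinearMap.toSpanSingleton K _ (MonoidAlgebra.single g 1)) ∘ₗ coeffAt K g := by
    ext x : 2
    simp [coeffAt_single, ]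
    split_ifs with hx
    · simp [hx]
    · simp
  rw [← LinearMap.comp_apply (TensorProduct.map _ _) (TensorProduct.map _ comul),
    ← TensorProduct.map_comp, h1, LinearMap.id_comp] at h
  simp only [proj, LinearMap.comp_apply, AlgHom.toLinearMap_apply]
  revert h
  generalize D.coact a = t
  intro h
  trans TensorProduct.map LinearMap.id
    (LinearMap.toSpanSingleton K (MonoidAlgebra K Γ) (MonoidAlgebra.single g 1) ∘ₗ coeffAt K g) t
  · rw [← h]
    clear h
    induction t with
    | zero => simp
    | add x y hx hy => simp only [map_add, hx, hy]
    | tmul x y =>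
      simp 
      generalize D.coact x = s
      induction s with
      | zero => simp
      | add x y hx hy => simp only [map_add, TensorProduct.add_tmul, hx, hy, smul_add]
      | tmul x z => simp
  · clear h
    induction t with
    | zero => simp
    | add x y hx hy => simp only [map_add, TensorProduct.add_tmul, hx, hy]
    | tmul x y => simp [TensorProduct.smul_tmul]

theorem proj_eq_self {g : Γ} {a : A} (ha : a ∈ D.component g) : D.proj g a = a := by
  classical
  rw [mem_component] at ha
  simp [proj, ha, coeffAt_single]

theorem proj_eq_zero {g h : Γ} {a : A} (ha : a ∈ D.component h) (hgh : h ≠ g) :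
    D.proj g a = 0 := by
  classical
  rw [mem_component] at ha
  simp [proj, ha, coeffAt_single, hgh]


theorem proj_apply_left (g : Γ) (a : A) : D.proj g a = TensorProduct.lid K A
    (TensorProduct.map (coeffAt K g ∘ₗ (D.p : A →ₗ[K] MonoidAlgebra K Γ)) LinearMap.id
      (comul (R := K) a)) := by
  have h := congrArg (fun t => TensorProduct.lid K A (TensorProduct.map (coeffAt K g) LinearMap.id t))
    (D.cocentral a)
  simp only [proj, LinearMap.comp_apply, AlgHom.toLinearMap_apply, coact_apply]
  revert h
  generalize comul (R := K) a = t
  intro h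
  trans (TensorProduct.lid K A) (TensorProduct.map (coeffAt K g) LinearMap.id
    (TensorProduct.map (D.p : A →ₗ[K] MonoidAlgebra K Γ) LinearMap.id (TensorProduct.comm K A A t)))
  · clear h
    induction t with
    | zero => simp
    | add x y hx hy => simp only [map_add, hx, hy]
    | tmul x y => simp
  · rw [← h]
    clear h
    induction t with
    | zero => simp
    | add x y hx hy => simp only [map_add, hx, hy]
    | tmul x y => simp

theorem comul_proj_right (g : Γ) (a : A) :
    TensorProduct.map LinearMap.id (D.proj g) (comul (R := K) a) = comul (D.proj g a) := by
  have h := congrArg (TensorProduct.map (LinearMap.id : A →ₗ[K] A)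
    ((TensorProduct.rid K A).toLinearMap ∘ₗ TensorProduct.map LinearMap.id
      (coeffAt K g ∘ₗ (D.p : A →ₗ[K] MonoidAlgebra K Γ)))) (Coalgebra.coassoc_apply (R := K) a)
  have e : ∀ x, D.proj g x = (TensorProduct.rid K A) (TensorProduct.map LinearMap.id
      (coeffAt K g ∘ₗ (D.p : A →ₗ[K] MonoidAlgebra K Γ)) (comul (R := K) x)) := by
    intro x
    simp only [proj, LinearMap.comp_apply, AlgHom.toLinearMap_apply, coact_apply]
    generalize comul (R := K) x = t
    induction t with
    | zero => simp
    | add x y hx hy => simp only [map_add, hx, hy]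
    | tmul x y => simp
  have e' : D.proj g = ((TensorProduct.rid K A).toLinearMap ∘ₗ TensorProduct.map LinearMap.id
      (coeffAt K g ∘ₗ (D.p : A →ₗ[K] MonoidAlgebra K Γ))) ∘ₗ comul := LinearMap.ext e
  trans TensorProduct.map (LinearMap.id : A →ₗ[K] A)
    ((TensorProduct.rid K A).toLinearMap ∘ₗ TensorProduct.map LinearMap.id
      (coeffAt K g ∘ₗ (D.p : A →ₗ[K] MonoidAlgebra K Γ))) (comul.lTensor A (comul (R := K) a))
  · rw [e', LinearMap.lTensor, ← LinearMap.comp_apply (TensorProduct.map _ _) (TensorProduct.map _ _),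
      ← TensorProduct.map_comp, LinearMap.id_comp]
  · rw [← h, e]
    clear h
    generalize comul (R := K) a = t
    induction t with
    | zero => simp
    | add x y hx hy => simp only [map_add, hx, hy]
    | tmul x y =>
      simp only [LinearMap.rTensor_tmul, TensorProduct.map_tmul, TensorProduct.rid_tmul, map_smul,
        LinearMap.id_apply]
      generalize comul (R := K) x = s
      induction s with
      | zero => simp
      | add x y hx hy => simp only [map_add, TensorProduct.add_tmul, hx, hy, smul_add]
      | tmul x z => simp

theorem comul_proj_left (g : Γ) (a : A) :
    TensorProduct.map (D.proj g) LinearMap.id (comul (R := K) a) = comul (D.proj g a) := by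
  have h := congrArg (TensorProduct.map
    ((TensorProduct.lid K A).toLinearMap ∘ₗ TensorProduct.map
      (coeffAt K g ∘ₗ (D.p : A →ₗ[K] MonoidAlgebra K Γ)) LinearMap.id) (LinearMap.id : A →ₗ[K] A))
      (Coalgebra.coassoc_symm_apply (R := K) a)
  have e' : D.proj g = ((TensorProduct.lid K A).toLinearMap ∘ₗ TensorProduct.map
      (coeffAt K g ∘ₗ (D.p : A →ₗ[K] MonoidAlgebra K Γ)) LinearMap.id) ∘ₗ comul :=
    LinearMap.ext (D.proj_apply_left g)
  trans TensorProduct.map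
    ((TensorProduct.lid K A).toLinearMap ∘ₗ TensorProduct.map
      (coeffAt K g ∘ₗ (D.p : A →ₗ[K] MonoidAlgebra K Γ)) LinearMap.id) (LinearMap.id : A →ₗ[K] A)
      (comul.rTensor A (comul (R := K) a))
  · rw [e', LinearMap.rTensor, ← LinearMap.comp_apply (TensorProduct.map _ _) (TensorProduct.map _ _),
      ← TensorProduct.map_comp, LinearMap.id_comp]
  · rw [← h, proj_apply_left]
    clear h
    generalize comul (R := K) a = t
    induction t with
    | zero => simp
    | add x y hx hy => simp only [map_add, hx, hy]
    | tmul x y =>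
      simp only [LinearMap.lTensor_tmul, TensorProduct.map_tmul, TensorProduct.lid_tmul, map_smul,
        LinearMap.id_apply]
      generalize comul (R := K) y = s
      induction s with
      | zero => simp
      | add x y hx hy => simp only [map_add, TensorProduct.tmul_add, hx, hy, smul_add]
      | tmul x z => simp [TensorProduct.smul_tmul']

/-- On a homogeneous component, `Δ(A_g) ⊆ A_g ⊗ A_g`. -/
theorem map_proj_comul {g : Γ} {a : A} (ha : a ∈ D.component g) :
    TensorProduct.map (D.proj g) (D.proj g) (comul (R := K) a) = comul a := by
  have h : TensorProduct.map (D.proj g) (D.proj g) =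
    TensorProduct.map (D.proj g) LinearMap.id ∘ₗ TensorProduct.map LinearMap.id (D.proj g) := by
    rw [← TensorProduct.map_comp, LinearMap.comp_id, LinearMap.id_comp]
  rw [h, LinearMap.comp_apply, comul_proj_right, D.proj_eq_self ha, comul_proj_left,
    D.proj_eq_self ha]

/-- Elements of `A_g ⊗ A_g` form the span of pure tensors; induction for the coproduct. -/
theorem comul_mem_span {g : Γ} {a : A} (ha : a ∈ D.component g) :
    comul (R := K) a ∈ Submodule.span K
      {t : A ⊗[K] A | ∃ x ∈ D.component g, ∃ y ∈ D.component g, t = x ⊗ₜ[K] y} := by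
  rw [← D.map_proj_comul ha]
  generalize comul (R := K) a = t
  induction t with
  | zero => simp
  | add x y hx hy => rw [map_add]; exact Submodule.add_mem _ hx hy
  | tmul x y =>
    exact Submodule.subset_span ⟨_, D.proj_mem g x, _, D.proj_mem g y, rfl⟩

/-- The action of `Γ` on the ring `A` given by `α`. -/
@[reducible]
def mulSemiringAction : MulSemiringAction Γ A where
  smul g a := D.act g a
  one_smul a := D.act_one a
  mul_smul g h a := D.act_mul g h a
  smul_zero g := map_zero (D.act g)
  smul_add g := map_add (D.act g)
  smul_one g := map_one (D.act g)
  smul_mul g := map_mul (D.act g)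

/-- The crossed product `A ⋊ Γ`, with `(a ⊗ g) (b ⊗ h) = a α_g(b) ⊗ gh`. -/
def CrossedProduct (_ : InvariantCocentralAction K Γ A) := SkewMonoidAlgebra A Γ

instance : Ring D.CrossedProduct :=
  letI := D.mulSemiringAction
  inferInstanceAs (Ring (SkewMonoidAlgebra A Γ))

instance : Module K D.CrossedProduct := inferInstanceAs (Module K (SkewMonoidAlgebra A Γ))

/-- The element `a ⊗ g`. -/
def single (g : Γ) : A →ₗ[K] D.CrossedProduct := SkewMonoidAlgebra.lsingle K g

theorem single_mul_single (g h : Γ) (a b : A) :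
    D.single g a * D.single h b = D.single (g * h) (a * D.act g b) :=
  letI := D.mulSemiringAction
  SkewMonoidAlgebra.single_mul_single (k := A) (G := Γ)

theorem one_def : (1 : D.CrossedProduct) = D.single 1 1 := rfl

theorem crossed_induction {P : D.CrossedProduct → Prop} (x : D.CrossedProduct) (h0 : P 0)
    (hs : ∀ g a, P (D.single g a)) (ha : ∀ x y, P x → P y → P (x + y)) : P x :=
  SkewMonoidAlgebra.induction_on x h0 hs ha

instance : Algebra K D.CrossedProduct := Algebra.ofModule
  (by
    intro r x y
    induction x using D.crossed_induction with
    | h0 => simp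
    | ha x y hx hy => simp only [smul_add, add_mul, hx, hy]
    | hs g a =>
      induction y using D.crossed_induction with
      | h0 => simp
      | ha x y hx hy => simp only [smul_add, mul_add, hx, hy]
      | hs h b => simp only [← map_smul, single_mul_single, smul_mul_assoc])
  (by
    intro r x y
    induction x using D.crossed_induction with
    | h0 => simp
    | ha x y hx hy => simp only [smul_add, add_mul, hx, hy]
    | hs g a =>
      induction y using D.crossed_induction with
      | h0 => simp
      | ha x y hx hy => simp only [smul_add, mul_add, hx, hy]
      | hs h b =>
        rw [← map_smul, single_mul_single, single_mul_single, map_smul, mul_smul_comm, map_smul])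

/-- The subspace `∑ g, A_g ⊗ g` of the crossed product. -/
def twistSubmodule : Submodule K D.CrossedProduct := ⨆ g, (D.component g).map (D.single g)

theorem single_mem {g : Γ} {a : A} (ha : a ∈ D.component g) : D.single g a ∈ D.twistSubmodule :=
  Submodule.mem_iSup_of_mem g ⟨a, ha, rfl⟩

theorem twist_induction {P : D.CrossedProduct → Prop} {x : D.CrossedProduct}
    (hx : x ∈ D.twistSubmodule) (h0 : P 0)
    (hs : ∀ g, ∀ a ∈ D.component g, P (D.single g a)) (ha : ∀ x y, P x → P y → P (x + y)) : P x := by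
  refine Submodule.iSup_induction _ (motive := P) hx ?_ h0 ha
  rintro g _ ⟨a, h, rfl⟩
  exact hs g a h

/-- The graded twisting `A^{t,α} = ∑ g, A_g ⊗ g`, as a subalgebra of the crossed product `A ⋊ Γ`.
Its coalgebra structure is transported from `A` along the linear isomorphism `j` below. -/
def twist : Subalgebra K D.CrossedProduct :=
  D.twistSubmodule.toSubalgebra (D.single_mem D.one_mem_component) (by
    intro x y hx hy
    refine D.twist_induction hx (P := fun x => x * y ∈ D.twistSubmodule) (by simp) ?_ ?_
    · intro g a ha
      refine D.twist_induction hy (P := fun y => D.single g a * y ∈ D.twistSubmodule) (by simp) ?_ ?_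
      · intro h b hb
        rw [single_mul_single]
        exact D.single_mem (D.mul_mem_component ha (D.act_mem_component hb))
      · intro x y hx hy
        rw [mul_add]; exact add_mem hx hy
    · intro x y hx hy
      rw [add_mul]; exact add_mem hx hy)


/-- The linear map `∑ g, a_g ↦ ∑ g, F g (a_g)`. -/
def extend {M : Type*} [AddCommGroup M] [Module K M] (F : Γ → A →ₗ[K] M) : A →ₗ[K] M :=
  TensorProduct.lift (LinearMap.flip ((Finsupp.lsum K fun g =>
    LinearMap.toSpanSingleton K _ (F g)) ∘ₗ (MonoidAlgebra.coeffLinearEquiv K).toLinearMap)) ∘ₗ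
      D.coact.toLinearMap

theorem extend_apply {M : Type*} [AddCommGroup M] [Module K M] (F : Γ → A →ₗ[K] M) {g : Γ} {a : A}
    (ha : a ∈ D.component g) : D.extend F a = F g a := by
  rw [mem_component] at ha
  simp [extend, ha]

theorem iSup_component : ⨆ g, D.component g = ⊤ := by
  classical
  rw [eq_top_iff]
  rintro a -
  have h1 : D.extend (fun _ => LinearMap.id) a = a := by
    have h := Coalgebra.lTensor_counit_comul (R := K) a
    have hp : (counit (R := K)) ∘ₗ (D.p : A →ₗ[K] MonoidAlgebra K Γ) = counit :=
      CoalgHomClass.counit_comp D.p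
    have h2 : a = TensorProduct.rid K A (TensorProduct.map LinearMap.id counit (D.coact a)) := by
      rw [coact_apply, ← LinearMap.comp_apply (TensorProduct.map _ _) (TensorProduct.map _ _),
        ← TensorProduct.map_comp, hp, LinearMap.id_comp]
      change a = TensorProduct.rid K A (counit.lTensor A (comul (R := K) a))
      rw [h]; simp
    conv_rhs => rw [h2]
    simp only [extend, LinearMap.comp_apply, AlgHom.toLinearMap_apply]
    generalize D.coact a = t
    induction t with
    | zero => simp
    | add x y hx hy => simp only [map_add, hx, hy]
    | tmul x y =>
      induction y using MonoidAlgebra.induction_linear with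
      | zero => simp
      | add x y hx hy => simp only [map_add, TensorProduct.tmul_add, hx, hy]
      | single g r => simp
  have h5 : ∃ s : Finset Γ, a = ∑ g ∈ s, D.proj g a := by
    have : ∀ t : A ⊗[K] MonoidAlgebra K Γ, ∃ s : Finset Γ, ∀ s', s ⊆ s' → 
        TensorProduct.lift (LinearMap.flip ((Finsupp.lsum K fun g : Γ =>
          LinearMap.toSpanSingleton K _ (LinearMap.id : A →ₗ[K] A)) ∘ₗ
          (MonoidAlgebra.coeffLinearEquiv K).toLinearMap)) t =
        ∑ g ∈ s', TensorProduct.rid K A (TensorProduct.map LinearMap.id (coeffAt K g) t) := by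
      intro t
      induction t with
      | zero => exact ⟨∅, by simp⟩
      | add x y hx hy =>
        obtain ⟨s, hs⟩ := hx
        obtain ⟨s2, hs2⟩ := hy
        refine ⟨s ∪ s2, fun s' h => ?_⟩
        rw [map_add, hs s' (Finset.union_subset_left h), hs2 s' (Finset.union_subset_right h),
          ← Finset.sum_add_distrib]
        simp only [map_add]
      | tmul x y =>
        induction y using MonoidAlgebra.induction_linear with
        | zero => exact ⟨∅, by simp⟩
        | add y z hx hy =>
          obtain ⟨s, hs⟩ := hx
          obtain ⟨s2, hs2⟩ := hy
          refine ⟨s ∪ s2, fun s' h => ?_⟩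
          rw [TensorProduct.tmul_add, map_add, hs s' (Finset.union_subset_left h),
            hs2 s' (Finset.union_subset_right h), ← Finset.sum_add_distrib]
          simp only [map_add]
        | single g r =>
          refine ⟨{g}, fun s' h => ?_⟩
          have hg : g ∈ s' := h (by simp)
          simp [coeffAt_single, hg, ite_smul]
    obtain ⟨s, hs⟩ := this (D.coact a)
    exact ⟨s, h1.symm.trans (hs s subset_rfl)⟩
  obtain ⟨s, hs⟩ := h5
  rw [hs]
  exact Submodule.sum_mem _ fun g _ => Submodule.mem_iSup_of_mem g (D.proj_mem g a)

theorem component_induction {P : A → Prop} (a : A) (h0 : P 0)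
    (hs : ∀ g, ∀ a ∈ D.component g, P a) (ha : ∀ x y, P x → P y → P (x + y)) : P a :=
  Submodule.iSup_induction D.component (motive := P) (x := a)
    (by rw [D.iSup_component]; trivial) hs h0 ha

theorem extend_single_mem (a : A) : D.extend (fun g => D.single g) a ∈ D.twist := by
  refine D.component_induction (P := fun a => D.extend (fun g => D.single g) a ∈ D.twist) a ?_ ?_ ?_
  · rw [map_zero]; exact zero_mem _
  · intro g a ha
    rw [D.extend_apply _ ha]
    exact D.single_mem ha
  · intro x y hx hy
    rw [map_add]; exact add_mem hx hy

/-- The linear map `∑ g, a_g ⊗ g ↦ ∑ g, a_g`. -/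
def sumMap : D.CrossedProduct →ₗ[K] A :=
  Finsupp.lsum K (fun _ => LinearMap.id) ∘ₗ
    (SkewMonoidAlgebra.coeffLinearEquiv (k := A) (G := Γ) (S := K)).toLinearMap

theorem sumMap_single (g : Γ) (a : A) : D.sumMap (D.single g a) = a := by
  change (Finsupp.lsum K (fun _ : Γ => (LinearMap.id : A →ₗ[K] A))) (Finsupp.single g a) = a
  simp

/-- The linear isomorphism `j : A → A^{t,α}`, `∑ g, a_g ↦ ∑ g, a_g ⊗ g`. -/
def j : A ≃ₗ[K] D.twist where
  toFun a := ⟨D.extend (fun g => D.single g) a, D.extend_single_mem a⟩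
  map_add' x y := Subtype.ext (map_add _ x y)
  map_smul' c x := Subtype.ext (map_smul _ c x)
  invFun x := D.sumMap x.1
  left_inv a := by
    refine D.component_induction (P := fun a => D.sumMap (D.extend (fun g => D.single g) a) = a)
      a (by simp) ?_ ?_
    · intro g a ha
      rw [D.extend_apply _ ha, sumMap_single]
    · intro x y hx hy
      rw [map_add, map_add, hx, hy]
  right_inv x := by
    apply Subtype.ext
    refine D.twist_induction (P := fun x => D.extend (fun g => D.single g) (D.sumMap x) = x)
      x.2 (by simp) ?_ ?_
    · intro g a ha
      rw [sumMap_single, D.extend_apply _ ha]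
    · intro x y hx hy
      rw [map_add, map_add, hx, hy]

theorem coe_j {g : Γ} {a : A} (ha : a ∈ D.component g) :
    (D.j a : D.CrossedProduct) = D.single g a := D.extend_apply _ ha

theorem j_mul {g : Γ} {a : A} (ha : a ∈ D.component g) (b : A) :
    D.j a * D.j b = D.j (a * D.act g b) := by
  refine D.component_induction (P := fun b => D.j a * D.j b = D.j (a * D.act g b)) b (by simp) ?_ ?_
  · intro h b hb
    apply Subtype.ext
    rw [Subalgebra.coe_mul, D.coe_j ha, D.coe_j hb, single_mul_single,
      D.coe_j (D.mul_mem_component ha (D.act_mem_component hb))]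
  · intro x y hx hy
    rw [map_add, map_add, mul_add, mul_add, map_add, hx, hy]

theorem j_one : D.j 1 = 1 := Subtype.ext (D.coe_j D.one_mem_component)

theorem twist_forall {P : D.twist → Prop} (x : D.twist) (h0 : P 0)
    (hs : ∀ g, ∀ a ∈ D.component g, P (D.j a)) (ha : ∀ x y, P x → P y → P (x + y)) : P x := by
  obtain ⟨a, rfl⟩ := D.j.surjective x
  exact D.component_induction (P := fun a => P (D.j a)) a (by simpa using h0) hs
    (fun x y hx hy => by rw [map_add]; exact ha _ _ hx hy)

/-- The coalgebra structure for which `j` is an isomorphism of coalgebras. -/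
instance twistCoalgebra : Coalgebra K D.twist :=
  retractCoalgebra D.j.symm.toLinearMap D.j.toLinearMap (by simp) (by
    intro b
    have : D.j.symm.toLinearMap ∘ₗ D.j.toLinearMap = LinearMap.id := by ext; simp
    rw [this, TensorProduct.map_id, LinearMap.id_apply])

theorem twist_counit (a : A) : counit (R := K) (D.j a) = counit (R := K) a := by
  change counit (R := K) (D.j.symm (D.j a)) = _
  rw [LinearEquiv.symm_apply_apply]

theorem twist_comul (a : A) : comul (R := K) (D.j a) =
    TensorProduct.map D.j.toLinearMap D.j.toLinearMap (comul (R := K) a) := by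
  change TensorProduct.map _ _ (comul (R := K) (D.j.symm (D.j a))) = _
  rw [LinearEquiv.symm_apply_apply]

instance twistBialgebra : Bialgebra K D.twist :=
  Bialgebra.mk' K D.twist
    (by rw [← j_one, twist_counit, Bialgebra.counit_one])
    (by
      intro x y
      obtain ⟨b, rfl⟩ := D.j.surjective y
      refine D.twist_forall (P := fun x => counit (R := K) (x * D.j b) = counit x * counit (D.j b))
        x (by simp) ?_ ?_
      · intro g a ha
        rw [D.j_mul ha, twist_counit, twist_counit, twist_counit, Bialgebra.counit_mul,
          CoalgHomClass.counit_comp_apply]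
      · intro x y hx hy
        rw [add_mul, map_add, map_add, hx, hy, add_mul])
    (by
      rw [← j_one, twist_comul, Bialgebra.comul_one, Algebra.TensorProduct.one_def,
        Algebra.TensorProduct.one_def, TensorProduct.map_tmul, LinearEquiv.coe_coe, j_one])
    (by
      intro x y
      obtain ⟨b, rfl⟩ := D.j.surjective y
      refine D.twist_forall (P := fun x => comul (R := K) (x * D.j b) = comul x * comul (D.j b))
        x (by simp) ?_ ?_
      · intro g a ha
        rw [D.j_mul ha, twist_comul, twist_comul, twist_comul, Bialgebra.comul_mul,
          ← CoalgHomClass.map_comp_comul_apply (D.act g) b]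
        have hs := D.comul_mem_span ha
        revert hs
        generalize comul (R := K) a = t
        intro hs
        induction hs using Submodule.span_induction with
        | zero => simp
        | add x y _ _ hx hy => simp only [add_mul, map_add, hx, hy]
        | smul c x _ hx => simp only [smul_mul_assoc, map_smul, hx]
        | mem x hx =>
          obtain ⟨x, hx, y, hy, rfl⟩ := hx
          generalize comul (R := K) b = u
          induction u with
          | zero => simp
          | add x y hx hy => simp only [mul_add, map_add, hx, hy]
          | tmul z w =>
            simp only [TensorProduct.map_tmul, Algebra.TensorProduct.tmul_mul_tmul,
              LinearEquiv.coe_coe, D.j_mul hx, D.j_mul hy]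
            rfl
      · intro x y hx hy
        rw [add_mul, map_add, map_add, hx, hy, add_mul])

theorem antipode_mem {g : Γ} {a : A} (ha : a ∈ D.component g) :
    antipode K a ∈ D.component g⁻¹ := by
  let G : A →ₗ[K] A ⊗[K] MonoidAlgebra K Γ := D.extend fun g =>
    (TensorProduct.mk K A (MonoidAlgebra K Γ)).flip (MonoidAlgebra.single g⁻¹ 1) ∘ₗ antipode K
  have h : WithConv.toConv (D.coact.toLinearMap ∘ₗ antipode K) = WithConv.toConv G := by
    apply left_inv_eq_right_inv (a := WithConv.toConv D.coact.toLinearMap)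
    · ext a
      rw [LinearMap.convMul_apply, LinearMap.convOne_apply]
      trans D.coact (LinearMap.mul' K A ((antipode K).rTensor A (comul (R := K) a)))
      · generalize comul (R := K) a = t
        induction t with
        | zero => simp
        | add x y hx hy => simp only [map_add, hx, hy]
        | tmul x y => simp
      · rw [mul_antipode_rTensor_comul_apply, AlgHom.commutes]
    · ext a
      rw [LinearMap.convMul_apply, LinearMap.convOne_apply]
      refine D.component_induction (P := fun a => LinearMap.mul' K (A ⊗[K] MonoidAlgebra K Γ)
        (TensorProduct.map D.coact.toLinearMap G (comul (R := K) a)) =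
        algebraMap K _ (counit (R := K) a)) a (by simp) ?_ ?_
      · intro g a ha
        trans (LinearMap.mul' K A ((antipode K).lTensor A (comul (R := K) a))) ⊗ₜ 1
        · have hs := D.comul_mem_span ha
          revert hs
          generalize comul (R := K) a = t
          intro hs
          induction hs using Submodule.span_induction with
          | zero => simp
          | add x y _ _ hx hy => simp only [map_add, hx, hy, TensorProduct.add_tmul]
          | smul c x _ hx => simp only [map_smul, hx, TensorProduct.smul_tmul']
          | mem x hx =>
            obtain ⟨x, hx, y, hy, rfl⟩ := hx
            have hy' : G y = antipode K y ⊗ₜ MonoidAlgebra.single g⁻¹ 1 := D.extend_apply _ hy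
            rw [TensorProduct.map_tmul, hy', AlgHom.toLinearMap_apply, D.mem_component.1 hx]
            simp [MonoidAlgebra.one_def]
        · rw [mul_antipode_lTensor_comul_apply]; rfl
      · intro x y hx hy
        simp only [map_add, hx, hy]
  have h2 := LinearMap.congr_fun (WithConv.toConv_injective h) a
  rw [mem_component]
  exact h2.trans (D.extend_apply _ ha)

/-- The antipode of the twisting, `a_g ⊗ g ↦ α_{g⁻¹}(S(a_g)) ⊗ g⁻¹`. -/
def twistAntipode : D.twist →ₗ[K] D.twist :=
  LinearMap.codRestrict (Subalgebra.toSubmodule D.twist)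
    (D.extend fun g => D.single g⁻¹ ∘ₗ (D.act g⁻¹ : A →ₗ[K] A) ∘ₗ antipode K) (by
      intro a
      refine D.component_induction (P := fun a => D.extend (fun g => D.single g⁻¹ ∘ₗ
        (D.act g⁻¹ : A →ₗ[K] A) ∘ₗ antipode K) a ∈ Subalgebra.toSubmodule D.twist) a ?_ ?_ ?_
      · rw [map_zero]; exact zero_mem _
      · intro g a ha
        rw [D.extend_apply _ ha]
        exact D.single_mem (D.act_mem_component (D.antipode_mem ha))
      · intro x y hx hy
        rw [map_add]; exact add_mem hx hy) ∘ₗ D.j.symm.toLinearMap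

theorem coe_twistAntipode {g : Γ} {a : A} (ha : a ∈ D.component g) :
    (D.twistAntipode (D.j a) : D.CrossedProduct) = D.single g⁻¹ (D.act g⁻¹ (antipode K a)) := by
  change D.extend (fun g => D.single g⁻¹ ∘ₗ (D.act g⁻¹ : A →ₗ[K] A) ∘ₗ antipode K)
    (D.j.symm (D.j a)) = _
  rw [LinearEquiv.symm_apply_apply, D.extend_apply _ ha]; rfl

theorem algebraMap_crossed (r : K) :
    algebraMap K D.CrossedProduct r = D.single 1 (algebraMap K A r) := by
  rw [Algebra.algebraMap_eq_smul_one, Algebra.algebraMap_eq_smul_one, map_smul]; rfl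

instance twistHopfAlgebra : HopfAlgebra K D.twist where
  antipode := D.twistAntipode
  mul_antipode_rTensor_comul := by
    ext x
    refine D.twist_forall (P := fun x => ((LinearMap.mul' K D.twist ∘ₗ
      D.twistAntipode.rTensor D.twist ∘ₗ comul) x : D.CrossedProduct) =
      ((Algebra.linearMap K D.twist ∘ₗ counit) x : D.twist)) x (by simp) ?_ ?_
    · intro g a ha
      simp only [LinearMap.comp_apply, twist_comul, twist_counit]
      trans D.single 1 (D.act g⁻¹ (LinearMap.mul' K A ((antipode K).rTensor A (comul (R := K) a))))
      · have hs := D.comul_mem_span ha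
        revert hs
        generalize comul (R := K) a = t
        intro hs
        induction hs using Submodule.span_induction with
        | zero => simp
        | add x y _ _ hx hy => simp only [map_add, Subalgebra.coe_add, hx, hy]
        | smul c x _ hx => simp only [map_smul, Subalgebra.coe_smul, hx]
        | mem x hx =>
          obtain ⟨x, hx, y, hy, rfl⟩ := hx
          simp only [TensorProduct.map_tmul, LinearMap.rTensor_tmul, LinearMap.mul'_apply,
            Subalgebra.coe_mul, LinearEquiv.coe_coe]
          rw [D.coe_twistAntipode hx, D.coe_j hy, single_mul_single, inv_mul_cancel, map_mul (D.act g⁻¹)]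
      · rw [mul_antipode_rTensor_comul_apply]
        change _ = algebraMap K D.CrossedProduct _
        rw [algebraMap_crossed, AlgHomClass.commutes]
    · intro x y hx hy
      rw [map_add, map_add, Subalgebra.coe_add, Subalgebra.coe_add, hx, hy]
  mul_antipode_lTensor_comul := by
    ext x
    refine D.twist_forall (P := fun x => ((LinearMap.mul' K D.twist ∘ₗ
      D.twistAntipode.lTensor D.twist ∘ₗ comul) x : D.CrossedProduct) =
      ((Algebra.linearMap K D.twist ∘ₗ counit) x : D.twist)) x (by simp) ?_ ?_
    · intro g a ha
      simp only [LinearMap.comp_apply, twist_comul, twist_counit]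
      trans D.single 1 (LinearMap.mul' K A ((antipode K).lTensor A (comul (R := K) a)))
      · have hs := D.comul_mem_span ha
        revert hs
        generalize comul (R := K) a = t
        intro hs
        induction hs using Submodule.span_induction with
        | zero => simp
        | add x y _ _ hx hy => simp only [map_add, Subalgebra.coe_add, hx, hy]
        | smul c x _ hx => simp only [map_smul, Subalgebra.coe_smul, hx]
        | mem x hx =>
          obtain ⟨x, hx, y, hy, rfl⟩ := hx
          simp only [TensorProduct.map_tmul, LinearMap.lTensor_tmul, LinearMap.mul'_apply,
            Subalgebra.coe_mul, LinearEquiv.coe_coe]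
          rw [D.coe_twistAntipode hy, D.coe_j hx, single_mul_single, mul_inv_cancel, ← D.act_mul,
            mul_inv_cancel, D.act_one]
      · rw [mul_antipode_lTensor_comul_apply]
        change _ = algebraMap K D.CrossedProduct _
        rw [algebraMap_crossed]
    · intro x y hx hy
      rw [map_add, map_add, Subalgebra.coe_add, Subalgebra.coe_add, hx, hy]

/-- The Hopf subalgebra `A_e`. Its structure maps are the restrictions of those of `A`. -/
def neutral : Subalgebra K A :=
  (D.component 1).toSubalgebra D.one_mem_component (by
    intro x y hx hy
    have := D.mul_mem_component hx hy
    rwa [mul_one] at this)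

/-- The projection of `A` onto `A_e`. -/
def toNeutral : A →ₗ[K] D.neutral :=
  LinearMap.codRestrict (Subalgebra.toSubmodule D.neutral) (D.proj 1) (D.proj_mem 1)

theorem map_toNeutral_comul (b : D.neutral) :
    TensorProduct.map (D.neutral.val.toLinearMap ∘ₗ D.toNeutral)
      (D.neutral.val.toLinearMap ∘ₗ D.toNeutral) (comul (R := K) (b : A)) = comul (b : A) :=
  D.map_proj_comul b.2

theorem val_neutral_injective : Function.Injective
    (Algebra.TensorProduct.map D.neutral.val D.neutral.val) := by
  apply Function.LeftInverse.injective (g := TensorProduct.map D.toNeutral D.toNeutral)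
  intro t
  induction t with
  | zero => simp
  | add x y hx hy => simp only [map_add, hx, hy]
  | tmul x y =>
    rw [Algebra.TensorProduct.map_tmul, TensorProduct.map_tmul]
    congr 1
    · exact Subtype.ext (D.proj_eq_self x.2)
    · exact Subtype.ext (D.proj_eq_self y.2)

instance neutralCoalgebra : Coalgebra K D.neutral :=
  retractCoalgebra D.neutral.val.toLinearMap D.toNeutral
    (fun b => Subtype.ext (D.proj_eq_self b.2)) D.map_toNeutral_comul

theorem neutral_counit (b : D.neutral) : counit (R := K) b = counit (R := K) (b : A) := rfl

theorem neutral_comul (b : D.neutral) :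
    Algebra.TensorProduct.map D.neutral.val D.neutral.val (comul (R := K) b) =
      comul (R := K) (b : A) := by
  refine Eq.trans ?_ (D.map_toNeutral_comul b)
  rw [TensorProduct.map_comp]; rfl

instance neutralBialgebra : Bialgebra K D.neutral :=
  Bialgebra.mk' K D.neutral
    (by rw [neutral_counit]; exact Bialgebra.counit_one)
    (by
      intro x y
      rw [neutral_counit, neutral_counit, neutral_counit]
      exact Bialgebra.counit_mul _ _)
    (by
      apply D.val_neutral_injective
      rw [neutral_comul, map_one]
      exact Bialgebra.comul_one)
    (by
      intro x y
      apply D.val_neutral_injective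
      rw [neutral_comul, map_mul, neutral_comul, neutral_comul]
      exact Bialgebra.comul_mul _ _)

/-- The antipode of `A_e`, the restriction of the antipode of `A`. -/
def neutralAntipode : D.neutral →ₗ[K] D.neutral :=
  LinearMap.codRestrict (Subalgebra.toSubmodule D.neutral)
    (antipode K ∘ₗ D.neutral.val.toLinearMap) (by
      intro b
      have := D.antipode_mem b.2
      rwa [inv_one] at this)

instance neutralHopfAlgebra : HopfAlgebra K D.neutral where
  antipode := D.neutralAntipode
  mul_antipode_rTensor_comul := by
    ext b
    refine Eq.trans ?_ (mul_antipode_rTensor_comul_apply (R := K) (b : A))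
    rw [← D.neutral_comul b]
    simp only [LinearMap.comp_apply]
    generalize comul (R := K) b = t
    induction t with
    | zero => simp
    | add x y hx hy => simp only [map_add, Subalgebra.coe_add, hx, hy]
    | tmul x y => rfl
  mul_antipode_lTensor_comul := by
    ext b
    refine Eq.trans ?_ (mul_antipode_lTensor_comul_apply (R := K) (b : A))
    rw [← D.neutral_comul b]
    simp only [LinearMap.comp_apply]
    generalize comul (R := K) b = t
    induction t with
    | zero => simp
    | add x y hx hy => simp only [map_add, Subalgebra.coe_add, hx, hy]
    | tmul x y => rfl

/-- `I` is `Γ`-graded: `I = ∑ g, I ∩ A_g` (the sum of the `A_g` is direct). -/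
def IsGradedIdeal (I : Ideal A) : Prop :=
  I.restrictScalars K = ⨆ g, I.restrictScalars K ⊓ D.component g

/-- `I` is `Γ`-stable: `α_g(I) ⊆ I` for all `g`. -/
def IsStableIdeal (I : Ideal A) : Prop := ∀ g, ∀ a ∈ I, D.act g a ∈ I

theorem p_apply {g : Γ} {a : A} (ha : a ∈ D.component g) :
    D.p a = counit (R := K) a • MonoidAlgebra.single g 1 := by
  have h := congrArg (fun t => TensorProduct.lid K _ (TensorProduct.map (counit (R := K) (A := A))
    (LinearMap.id : MonoidAlgebra K Γ →ₗ[K] _) t)) (D.mem_component.1 ha)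
  simp only [TensorProduct.map_tmul, TensorProduct.lid_tmul, LinearMap.id_apply, coact_apply] at h
  rw [← h]
  have h2 := Coalgebra.rTensor_counit_comul (R := K) a
  have h3 := congrArg (fun t => TensorProduct.lid K _ (TensorProduct.map (LinearMap.id : K →ₗ[K] K)
    (D.p : A →ₗ[K] MonoidAlgebra K Γ) t)) h2
  simp only [TensorProduct.map_tmul, TensorProduct.lid_tmul, LinearMap.id_apply, one_smul] at h3
  refine Eq.trans h3.symm ?_
  generalize comul (R := K) a = t
  induction t with
  | zero => simp
  | add x y hx hy => simp only [map_add, hx, hy]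
  | tmul x y => simp

theorem p_eq_zero {I : Ideal A} [I.IsHopfIdeal K] (hI : D.IsGradedIdeal I) {a : A} (ha : a ∈ I) :
    D.p a = 0 := by
  have h : a ∈ ⨆ g, I.restrictScalars K ⊓ D.component g := hI ▸ ha
  refine Submodule.iSup_induction _ (motive := fun a => D.p a = 0) h ?_ (map_zero _) ?_
  · intro g x hx
    rw [D.p_apply hx.2, Submodule.IsCoideal.counit_eq_zero (R := K) (I := I.restrictScalars K) hx.1,
      zero_smul]
  · intro x y hx hy
    rw [map_add, hx, hy, add_zero]

section Quotient
variable (I : Ideal A) [I.IsTwoSided] [I.IsHopfIdeal K]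

/-- A bialgebra homomorphism vanishing on the Hopf ideal `I` descends to `A ⧸ I`. -/
def quotientLift {B : Type*} [Ring B] [Bialgebra K B] (f : A →ₐc[K] B) (hf : ∀ a ∈ I, f a = 0) :
    (A ⧸ I) →ₐc[K] B :=
  BialgHom.ofAlgHom (Ideal.Quotient.liftₐ I (f : A →ₐ[K] B) hf)
    (by
      refine Ideal.Quotient.algHom_ext K (AlgHom.ext fun a => ?_)
      exact CoalgHomClass.counit_comp_apply f a)
    (by
      refine Ideal.Quotient.algHom_ext K (AlgHom.ext fun a => ?_)
      refine Eq.trans ?_ (CoalgHomClass.map_comp_comul_apply f a)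
      change Algebra.TensorProduct.map (Ideal.Quotient.liftₐ I (f : A →ₐ[K] B) hf)
        (Ideal.Quotient.liftₐ I (f : A →ₐ[K] B) hf) (TensorProduct.map
          (Ideal.Quotient.mkₐ K I).toLinearMap (Ideal.Quotient.mkₐ K I).toLinearMap
          (comul (R := K) a)) = _
      generalize comul (R := K) a = t
      induction t with
      | zero => simp
      | add x y hx hy => simp only [map_add, hx, hy]
      | tmul x y => rfl)

theorem quotientLift_mk {B : Type*} [Ring B] [Bialgebra K B] (f : A →ₐc[K] B)
    (hf : ∀ a ∈ I, f a = 0) (a : A) : quotientLift I f hf (Ideal.Quotient.mk I a) = f a := rfl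

/-- The endomorphism of `A ⧸ I` induced by `α_g`. -/
def quotientAct (hst : D.IsStableIdeal I) (g : Γ) : (A ⧸ I) →ₐc[K] (A ⧸ I) :=
  quotientLift I ((Bialgebra.Quotient.mkBialgHom I).comp (D.act g : A →ₐc[K] A))
    (fun a ha => Ideal.Quotient.eq_zero_iff_mem.2 (hst g a ha))

theorem quotientAct_mk (hst : D.IsStableIdeal I) (g : Γ) (a : A) :
    D.quotientAct I hst g (Ideal.Quotient.mk I a) = Ideal.Quotient.mk I (D.act g a) := rfl

/-- The invariant cocentral action `(p̄, ᾱ)` induced on the quotient by a graded stable Hopf ideal. -/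
def quotient (hgr : D.IsGradedIdeal I) (hst : D.IsStableIdeal I) :
    InvariantCocentralAction K Γ (A ⧸ I) where
  p := quotientLift I D.p (fun _ ha => D.p_eq_zero hgr ha)
  cocentral x := by
    obtain ⟨a, rfl⟩ := Ideal.Quotient.mk_surjective x
    have h := congrArg (TensorProduct.map (LinearMap.id : MonoidAlgebra K Γ →ₗ[K] _)
      (Ideal.Quotient.mkₐ K I).toLinearMap) (D.cocentral a)
    rw [Bialgebra.Quotient.comul_mk]
    revert h
    generalize comul (R := K) a = t
    intro h
    refine Eq.trans ?_ (h.trans ?_)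
    · clear h
      induction t with
      | zero => simp
      | add x y hx hy => simp only [map_add, hx, hy]
      | tmul x y => rfl
    · clear h
      induction t with
      | zero => simp
      | add x y hx hy => simp only [map_add, hx, hy]
      | tmul x y => rfl
  act g := BialgEquiv.ofBialgHom (D.quotientAct I hst g) (D.quotientAct I hst g⁻¹)
    (by
      ext x
      obtain ⟨a, rfl⟩ := Ideal.Quotient.mk_surjective x
      change D.quotientAct I hst g (D.quotientAct I hst g⁻¹ (Ideal.Quotient.mk I a)) = _
      rw [quotientAct_mk, quotientAct_mk, ← D.act_mul, mul_inv_cancel, D.act_one]; rfl)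
    (by
      ext x
      obtain ⟨a, rfl⟩ := Ideal.Quotient.mk_surjective x
      change D.quotientAct I hst g⁻¹ (D.quotientAct I hst g (Ideal.Quotient.mk I a)) = _
      rw [quotientAct_mk, quotientAct_mk, ← D.act_mul, inv_mul_cancel, D.act_one]; rfl)
  act_one x := by
    obtain ⟨a, rfl⟩ := Ideal.Quotient.mk_surjective x
    exact congrArg (Ideal.Quotient.mk I) (D.act_one a)
  act_mul g h x := by
    obtain ⟨a, rfl⟩ := Ideal.Quotient.mk_surjective x
    exact congrArg (Ideal.Quotient.mk I) (D.act_mul g h a)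
  p_act g x := by
    obtain ⟨a, rfl⟩ := Ideal.Quotient.mk_surjective x
    exact D.p_act g a

end Quotient

end
end InvariantCocentralAction

/-! ### Subcoalgebras: intersections and independence. -/

section Subcoalgebra
open Coalgebra

/-! Write `φ = f ∘ j : A → L` (`onBase`), a surjective coalgebra map, and let `C_g = φ(A_g)`
(`image`). The `C_g` are subcoalgebras spanning `L`, with `C_g C_h ⊆ C_{gh}` and `S(C_g) ⊆ C_{g⁻¹}`.
Everything depends on whether they overlap.

If `C_g` and `C_h` meet nontrivially, they share an element `c` with `ε(c) = 1` and `Δ(c) ∈ C_g ⊗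
C_h`, so `1 = c₁ S(c₂)` lies in `C_{gh⁻¹}` (`one_mem_image_of_not_disjoint`). The degrees `g` with
`1 ∈ C_g` form a subgroup of `Γ` (`unitDegrees`). Since `Γ` has prime order, this subgroup is
everything or trivial.

If it is everything, then `C_g = C_g · 1 ⊆ C_g C_{g⁻¹} ⊆ C_e` for all `g`. Hence `L = C_e` is a
quotient of the commutative Hopf algebra `A_e`, which is case (i).

If it is trivial, the `C_g` are pairwise disjoint. For subcoalgebras this already gives a direct sum
(`Submodule.IsSubcoalgebra.iSupIndep`), so `I = ker φ` is graded. The rule `φ(a) φ(b) = φ(a α_g(b))`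
for `a ∈ A_g`, together with commutativity of `A`, makes `I` an ideal. Surjectivity of `p` supplies
elements of counit `1` in every degree, which makes `I` stable (`isStableIdeal_kerIdeal`). Then `I`
is a Hopf ideal and `φ` induces an isomorphism from the twisting of `A ⧸ I` onto `L`, which is case
(ii). -/

/-- `C` is a subcoalgebra: `Δ(C) ⊆ C ⊗ C`. -/
def Submodule.IsSubcoalgebra {K V : Type*} [Field K] [AddCommGroup V] [Module K V]
    [Coalgebra K V] (C : Submodule K V) : Prop :=
  ∀ c ∈ C, comul (R := K) c ∈ LinearMap.range (TensorProduct.map C.subtype C.subtype)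

namespace Submodule.IsSubcoalgebra
variable {K V : Type*} [Field K] [AddCommGroup V] [Module K V] [Coalgebra K V]
variable {C D E : Submodule K V}

theorem sup (hC : C.IsSubcoalgebra) (hD : D.IsSubcoalgebra) : (C ⊔ D).IsSubcoalgebra := by
  intro x hx
  obtain ⟨c, hc, d, hd, rfl⟩ := Submodule.mem_sup.1 hx
  rw [map_add]
  have key : ∀ B : Submodule K V, B ≤ C ⊔ D →
      LinearMap.range (TensorProduct.map B.subtype B.subtype) ≤
        LinearMap.range (TensorProduct.map (C ⊔ D).subtype (C ⊔ D).subtype) := by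
    rintro B hB _ ⟨t, rfl⟩
    exact ⟨TensorProduct.map (Submodule.inclusion hB) (Submodule.inclusion hB) t, by
      rw [← LinearMap.comp_apply, ← TensorProduct.map_comp]; rfl⟩
  exact add_mem (key C le_sup_left (hC c hc)) (key D le_sup_right (hD d hd))

theorem bot : (⊥ : Submodule K V).IsSubcoalgebra := by
  intro c hc
  rw [(Submodule.mem_bot K).1 hc, map_zero]
  exact zero_mem _

/-- The map `c ↦ φ(c₁) c₂`. -/
noncomputable def slice (φ : V →ₗ[K] K) : V →ₗ[K] V :=
  (TensorProduct.lid K V).toLinearMap ∘ₗ φ.rTensor V ∘ₗ comul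

theorem slice_counit (c : V) : slice (counit (R := K)) c = c := by
  simp [slice]

/-- Both sides are `φ(c₁) ε(c₂)`. This allows the counit of a slice to be prescribed by the choice
of `φ`. -/
theorem counit_slice (φ : V →ₗ[K] K) (c : V) : counit (R := K) (slice φ c) = φ c := by
  have h := congrArg (fun t => TensorProduct.rid K K (TensorProduct.map φ LinearMap.id t))
    (Coalgebra.lTensor_counit_comul (R := K) c)
  simp only [TensorProduct.map_tmul, TensorProduct.rid_tmul, LinearMap.id_apply, one_smul] at h
  rw [← h]
  simp only [slice, LinearMap.comp_apply]
  generalize comul (R := K) c = t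
  induction t with
  | zero => simp
  | add x y hx hy => simp only [map_add, hx, hy]
  | tmul x y => simp [mul_comm]

theorem slice_mem (hC : C.IsSubcoalgebra) (φ : V →ₗ[K] K) {c : V} (hc : c ∈ C) :
    slice φ c ∈ C := by
  obtain ⟨t, ht⟩ := hC c hc
  simp only [slice, LinearMap.comp_apply]
  rw [← ht]
  clear ht
  induction t with
  | zero => simp
  | add x y hx hy => simp only [map_add]; exact add_mem hx hy
  | tmul x y => simpa using C.smul_mem _ y.2

/-- The left leg of `Δ(c)` lies in `C`, so only the restriction of `φ` to `C` matters. -/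
theorem slice_congr (hC : C.IsSubcoalgebra) {φ ψ : V →ₗ[K] K} (h : ∀ c ∈ C, φ c = ψ c) {c : V}
    (hc : c ∈ C) : slice φ c = slice ψ c := by
  obtain ⟨t, ht⟩ := hC c hc
  simp only [slice, LinearMap.comp_apply]
  rw [← ht]
  clear ht
  induction t with
  | zero => simp
  | add x y hx hy => simp only [map_add, hx, hy]
  | tmul x y => simp [h x x.2]

/-- False for arbitrary subspaces. Here a functional equal to `ε` on `C` and to `0` on `D` gives a
slice that fixes `C`, kills `D` and preserves `E`. Applied to `d + e ∈ C`, it shows that this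
element lies in `E`, hence in `C ∩ E = 0`. -/
theorem disjoint_sup (hC : C.IsSubcoalgebra) (hD : D.IsSubcoalgebra) (hE : E.IsSubcoalgebra)
    (hCD : Disjoint C D) (hCE : Disjoint C E) : Disjoint C (D ⊔ E) := by
  obtain ⟨U, hDU, hCU⟩ := hCD.symm.exists_isCompl
  rw [Submodule.disjoint_def] at hCE ⊢
  intro x hx hx'
  apply hCE x hx
  obtain ⟨d, hd, e, he, rfl⟩ := Submodule.mem_sup.1 hx'
  -- The complement `U` of `C` was chosen to contain `D`, so projecting along it kills `D`.
  let φ : V →ₗ[K] K := counit ∘ₗ C.projection U hCU.symm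
  have h1 : slice φ (d + e) = d + e := by
    rw [hC.slice_congr (ψ := counit) _ hx, slice_counit]
    intro c hc
    have := Submodule.projection_apply_left hCU.symm ⟨c, hc⟩
    simp only [φ, LinearMap.comp_apply]
    rw [this]
  have h2 : slice φ d = 0 := by
    rw [hD.slice_congr (ψ := 0) _ hd]
    · simp [slice]
    · intro c hc
      have := (Submodule.projection_apply_eq_zero_iff hCU.symm).2 (hDU hc)
      simp only [φ, LinearMap.comp_apply]
      rw [this, map_zero, LinearMap.zero_apply]
  rw [← h1, map_add, h2, zero_add]
  exact hE.slice_mem φ he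

/-- A finite sum of subcoalgebras is again one, so `disjoint_sup` can be iterated to separate each
`C i` from any finite sum of the others. -/
theorem iSupIndep {ι : Type*} {C : ι → Submodule K V} (hC : ∀ i, (C i).IsSubcoalgebra)
    (h : ∀ i j, i ≠ j → Disjoint (C i) (C j)) : iSupIndep C := by
  classical
  have key : ∀ s : Finset ι, (s.sup C).IsSubcoalgebra ∧ ∀ i ∉ s, Disjoint (C i) (s.sup C) := by
    intro s
    induction s using Finset.induction_on with
    | empty => exact ⟨by simpa using bot, by simp⟩
    | insert j s hj ih =>
      rw [Finset.sup_insert]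
      refine ⟨(hC j).sup ih.1, fun i hi => ?_⟩
      rw [Finset.mem_insert, not_or] at hi
      exact (hC i).disjoint_sup (hC j) ih.1 (h i j hi.1) (ih.2 i hi.2)
  rw [iSupIndep_iff_finsetSum_eq_zero_imp_eq_zero]
  intro s v hv h0 i hi
  refine Submodule.disjoint_def.1 ((key (s.erase i)).2 i (by simp)) _ (hv i hi) ?_
  rw [← Finset.add_sum_erase s v hi] at h0
  rw [eq_neg_of_add_eq_zero_left h0]
  refine neg_mem (Submodule.sum_mem _ fun j hj => ?_)
  exact Finset.le_sup (f := C) hj (hv j (Finset.mem_of_mem_erase hj))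

/-- Two subcoalgebras meeting nontrivially share an element of counit `1` with coproduct in
`C ⊗ D`. -/
theorem exists_counit_eq_one (hC : C.IsSubcoalgebra) (hD : D.IsSubcoalgebra)
    (h : ¬ Disjoint C D) : ∃ c : V, counit (R := K) c = 1 ∧
      comul (R := K) c ∈ LinearMap.range (TensorProduct.map C.subtype D.subtype) := by
  rw [Submodule.disjoint_def] at h
  push Not at h
  obtain ⟨c, hcC, hcD, hc⟩ := h
  -- A functional with `φ c ≠ 0`. Slicing `c` by `(φ c)⁻¹ • φ` stays in both `C` and `D` and has
  -- counit `1`.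
  obtain ⟨φ, hφ, -⟩ := Submodule.exists_le_ker_of_notMem (p := (⊥ : Submodule K V)) (v := c)
    (by simpa using hc)
  obtain ⟨U, hU⟩ := C.exists_isCompl
  obtain ⟨W, hW⟩ := D.exists_isCompl
  have hxC := hC.slice_mem ((φ c)⁻¹ • φ) hcC
  have hxD := hD.slice_mem ((φ c)⁻¹ • φ) hcD
  have h1 : counit (R := K) (slice ((φ c)⁻¹ • φ) c) = 1 := by
    rw [counit_slice, LinearMap.smul_apply, smul_eq_mul, inv_mul_cancel₀ hφ]
  generalize slice ((φ c)⁻¹ • φ) c = x at hxC hxD h1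
  -- `Δ(x)` lies in `C ⊗ C` and in `D ⊗ D`. It is therefore fixed by projecting the left leg to `C`
  -- and the right leg to `D`, which puts it in `C ⊗ D`.
  refine ⟨x, h1, TensorProduct.map (C.projectionOnto U hU) (D.projectionOnto W hW)
    (comul (R := K) x), ?_⟩
  obtain ⟨t, ht⟩ := hC x hxC
  obtain ⟨s, hs⟩ := hD x hxD
  have e1 : (TensorProduct.map C.subtype D.subtype) ∘ₗ
      (TensorProduct.map (C.projectionOnto U hU) (D.projectionOnto W hW)) =
      TensorProduct.map (C.subtype ∘ₗ C.projectionOnto U hU) LinearMap.id ∘ₗ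
        TensorProduct.map LinearMap.id (D.subtype ∘ₗ D.projectionOnto W hW) := by
    rw [← TensorProduct.map_comp, ← TensorProduct.map_comp, LinearMap.comp_id, LinearMap.id_comp]
  have e2 : TensorProduct.map LinearMap.id (D.subtype ∘ₗ D.projectionOnto W hW)
      (comul (R := K) x) = comul x := by
    rw [← hs, ← LinearMap.comp_apply, ← TensorProduct.map_comp, LinearMap.comp_assoc,
      Submodule.projectionOnto_comp_subtype, LinearMap.comp_id, LinearMap.id_comp]
  have e3 : TensorProduct.map (C.subtype ∘ₗ C.projectionOnto U hU) LinearMap.id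
      (comul (R := K) x) = comul x := by
    rw [← ht, ← LinearMap.comp_apply, ← TensorProduct.map_comp, LinearMap.comp_assoc,
      Submodule.projectionOnto_comp_subtype, LinearMap.comp_id, LinearMap.id_comp]
  rw [← LinearMap.comp_apply, e1, LinearMap.comp_apply, e2, e3]

end Submodule.IsSubcoalgebra
end Subcoalgebra

/-! ### Compatibility of bialgebra homomorphisms with antipodes. -/

section Antipode
open Coalgebra HopfAlgebra LinearMap WithConv

/-- A bialgebra homomorphism between Hopf algebras commutes with the antipodes. -/
theorem BialgHom.map_antipode {K A B : Type*} [Field K] [Ring A] [Ring B] [HopfAlgebra K A]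
    [HopfAlgebra K B] (f : A →ₐc[K] B) (a : A) : f (antipode K a) = antipode K (f a) := by
  have h : toConv ((f : A →ₗ[K] B) ∘ₗ antipode K) = toConv (antipode K ∘ₗ (f : A →ₗ[K] B)) := by
    -- `f ∘ S` is a left convolution inverse of `f` and `S ∘ f` a right one, so they coincide.
    apply left_inv_eq_right_inv (a := toConv (f : A →ₗ[K] B))
    · apply ofConv_injective
      calc (toConv ((f : A →ₗ[K] B) ∘ₗ antipode K) * toConv (f : A →ₗ[K] B)).ofConv
          = (AlgHomClass.toAlgHom f).toLinearMap ∘ₗ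
            (toConv (antipode K) * toConv .id : WithConv (A →ₗ[K] A)).ofConv := by
            rw [algHom_comp_convMul_distrib]; rfl
        _ = _ := by rw [antipode_mul_id, algHom_comp_convOne]
    · apply ofConv_injective
      calc (toConv (f : A →ₗ[K] B) * toConv (antipode K ∘ₗ (f : A →ₗ[K] B))).ofConv
          = (toConv .id * toConv (antipode K) : WithConv (B →ₗ[K] B)).ofConv ∘ₗ
            f.toCoalgHom.toLinearMap := by
            rw [convMul_comp_coalgHom_distrib]; rfl
        _ = _ := by rw [id_mul_antipode, ← convOne_comp_coalgHom f.toCoalgHom]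
  exact LinearMap.congr_fun (toConv_injective h) a

end Antipode

namespace InvariantCocentralAction
noncomputable section
open Coalgebra HopfAlgebra
variable {K Γ A : Type*} [Field K] [Group Γ]

/-! ### Images of the homogeneous components in a quotient of the twisting. -/

section Ring
variable [Ring A] [HopfAlgebra K A] (D : InvariantCocentralAction K Γ A)
variable {L : Type*} [Ring L] [HopfAlgebra K L] (f : D.twist →ₐc[K] L)

theorem sum_proj [Fintype Γ] (a : A) : ∑ g, D.proj g a = a := by
  refine D.component_induction (P := fun a => ∑ g, D.proj g a = a) a (by simp) ?_ ?_
  · intro h a ha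
    rw [Finset.sum_eq_single h, D.proj_eq_self ha]
    · intro g _ hg
      exact D.proj_eq_zero ha hg.symm
    · simp
  · intro x y hx hy
    simp only [map_add, Finset.sum_add_distrib, hx, hy]

theorem counit_proj (g : Γ) (a : A) : counit (R := K) (D.proj g a) = coeffAt K g (D.p a) := by
  classical
  refine D.component_induction
    (P := fun a => counit (R := K) (D.proj g a) = coeffAt K g (D.p a)) a (by simp) ?_ ?_
  · intro h a ha
    rw [D.p_apply ha, map_smul, coeffAt_single]
    split_ifs with hg
    · subst hg
      rw [D.proj_eq_self ha, smul_eq_mul, mul_one]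
    · rw [D.proj_eq_zero ha hg, map_zero, smul_zero]
  · intro x y hx hy
    simp only [map_add, hx, hy]

/-- The degree `g` part of any preimage of `g` under `p` works, because its counit is the
coefficient of `p(a)` at `g`. -/
theorem exists_counit_eq_one (hp : Function.Surjective D.p) (g : Γ) :
    ∃ b ∈ D.component g, counit (R := K) b = 1 := by
  classical
  obtain ⟨a, ha⟩ := hp (MonoidAlgebra.single g 1)
  exact ⟨D.proj g a, D.proj_mem g a, by rw [counit_proj, ha, coeffAt_single, if_pos rfl]⟩

/-- A homomorphism on the twisting, as a linear map on `A`. -/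
def onBase : A →ₗ[K] L := (f : D.twist →ₗ[K] L) ∘ₗ D.j.toLinearMap

theorem onBase_apply (a : A) : D.onBase f a = f (D.j a) := rfl

theorem onBase_one : D.onBase f 1 = 1 := by rw [onBase_apply, j_one, map_one]

/-- Only the degree of the left factor enters the crossed product rule, so `b` may be inhomogeneous.
-/
theorem onBase_mul {g : Γ} {a : A} (ha : a ∈ D.component g) (b : A) :
    D.onBase f a * D.onBase f b = D.onBase f (a * D.act g b) := by
  simp only [onBase_apply]
  rw [← map_mul, D.j_mul ha]

theorem onBase_counit (a : A) : counit (R := K) (D.onBase f a) = counit (R := K) a := by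
  rw [onBase_apply, CoalgHomClass.counit_comp_apply, twist_counit]

theorem onBase_comul (a : A) : comul (R := K) (D.onBase f a) =
    TensorProduct.map (D.onBase f) (D.onBase f) (comul (R := K) a) := by
  rw [onBase_apply, ← CoalgHomClass.map_comp_comul_apply, twist_comul, ← LinearMap.comp_apply,
    ← TensorProduct.map_comp]
  rfl

/-- In degree `g` the antipode of the twisting is `α_{g⁻¹} ∘ S`, and `f` commutes with antipodes. -/
theorem antipode_onBase {g : Γ} {a : A} (ha : a ∈ D.component g) :
    antipode K (D.onBase f a) = D.onBase f (D.act g⁻¹ (antipode K a)) := by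
  rw [onBase_apply, ← BialgHom.map_antipode, onBase_apply]
  congr 1
  apply Subtype.ext
  rw [D.coe_j (D.act_mem_component (D.antipode_mem ha))]
  exact D.coe_twistAntipode ha

/-- The image of the homogeneous component `A_g`. -/
def image (g : Γ) : Submodule K L := (D.component g).map (D.onBase f)

theorem onBase_mem_image {g : Γ} {a : A} (ha : a ∈ D.component g) : D.onBase f a ∈ D.image f g :=
  Submodule.mem_map_of_mem ha

theorem isSubcoalgebra_image (g : Γ) : (D.image f g).IsSubcoalgebra := by
  rintro _ ⟨a, ha, rfl⟩
  rw [onBase_comul]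
  have hs := D.comul_mem_span ha
  generalize comul (R := K) a = t at hs
  induction hs using Submodule.span_induction with
  | zero => rw [map_zero]; exact zero_mem _
  | add x y _ _ hx hy => rw [map_add]; exact add_mem hx hy
  | smul c x _ hx => rw [map_smul]; exact Submodule.smul_mem _ _ hx
  | mem x hx =>
    obtain ⟨x, hx, y, hy, rfl⟩ := hx
    exact ⟨⟨_, D.onBase_mem_image f hx⟩ ⊗ₜ ⟨_, D.onBase_mem_image f hy⟩, rfl⟩

theorem mul_mem_image {g h : Γ} {x y : L} (hx : x ∈ D.image f g) (hy : y ∈ D.image f h) :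
    x * y ∈ D.image f (g * h) := by
  obtain ⟨a, ha, rfl⟩ := hx
  obtain ⟨b, hb, rfl⟩ := hy
  rw [D.onBase_mul f ha]
  exact D.onBase_mem_image f (D.mul_mem_component ha (D.act_mem_component hb))

theorem antipode_mem_image {g : Γ} {x : L} (hx : x ∈ D.image f g) :
    antipode K x ∈ D.image f g⁻¹ := by
  obtain ⟨a, ha, rfl⟩ := hx
  rw [D.antipode_onBase f ha]
  exact D.onBase_mem_image f (D.act_mem_component (D.antipode_mem ha))

/-- For a common element `c` with `ε(c) = 1` and `Δ(c) ∈ C_g ⊗ C_h`, the antipode axiom gives `1 =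
c₁ S(c₂) ∈ C_g C_{h⁻¹}`. -/
theorem one_mem_image_of_not_disjoint {g h : Γ} (hgh : ¬ Disjoint (D.image f g) (D.image f h)) :
    (1 : L) ∈ D.image f (g * h⁻¹) := by
  obtain ⟨c, hc, t, ht⟩ :=
    (D.isSubcoalgebra_image f g).exists_counit_eq_one (D.isSubcoalgebra_image f h) hgh
  have h1 := mul_antipode_lTensor_comul_apply (R := K) c
  rw [hc, map_one] at h1
  rw [← h1, ← ht]
  clear ht
  induction t with
  | zero => simp
  | add x y hx hy => simp only [map_add]; exact add_mem hx hy
  | tmul x y => exact D.mul_mem_image f x.2 (D.antipode_mem_image f y.2)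

/-- The degrees whose image contains `1`. -/
def unitDegrees : Subgroup Γ where
  carrier := {g | (1 : L) ∈ D.image f g}
  one_mem' := by
    have := D.onBase_mem_image f D.one_mem_component
    rwa [onBase_one] at this
  mul_mem' {g h} hg hh := by
    have := D.mul_mem_image f hg hh
    rwa [one_mul] at this
  inv_mem' {g} hg := by
    have := D.antipode_mem_image f hg
    rwa [antipode_one] at this

/-- Multiplying an element of `C_g` by `1 ∈ C_{g⁻¹}` moves it into `C_e` without changing it. -/
theorem image_one_eq_top (hf : Function.Surjective f) (h : D.unitDegrees f = ⊤) :
    D.image f 1 = ⊤ := by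
  rw [eq_top_iff]
  rintro x -
  obtain ⟨y, rfl⟩ := hf x
  obtain ⟨a, rfl⟩ := D.j.surjective y
  refine D.component_induction (P := fun a => f (D.j a) ∈ D.image f 1) a (by simp) ?_ ?_
  · intro g a ha
    have h1 : g⁻¹ ∈ D.unitDegrees f := h ▸ Subgroup.mem_top _
    have := D.mul_mem_image f (D.onBase_mem_image f ha) h1
    rwa [mul_one, mul_inv_cancel] at this
  · intro x y hx hy
    simp only [map_add]
    exact add_mem hx hy

/-- The elements `φ(a_g) ∈ C_g` sum to `φ(a) = 0`, so independence makes each vanish: the kernel of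
`φ` is graded. -/
theorem onBase_proj_eq_zero [Finite Γ] (h : iSupIndep (D.image f)) {a : A}
    (ha : D.onBase f a = 0) (g : Γ) : D.onBase f (D.proj g a) = 0 := by
  have := Fintype.ofFinite Γ
  rw [iSupIndep_iff_finsetSum_eq_zero_imp_eq_zero] at h
  refine h Finset.univ (fun g => D.onBase f (D.proj g a))
    (fun g _ => D.onBase_mem_image f (D.proj_mem g a)) ?_ g (Finset.mem_univ g)
  rw [← map_sum, D.sum_proj, ha]

/-- The restriction to `A_e` of a homomorphism on the twisting. -/
def onNeutral : D.neutral →ₐc[K] L :=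
  BialgHom.ofAlgHom
    (AlgHom.ofLinearMap (D.onBase f ∘ₗ D.neutral.val.toLinearMap) (D.onBase_one f) (by
      intro x y
      -- In degree `e` the twist is by `α_e = id`, so `φ` is multiplicative on `A_e`.
      refine Eq.trans ?_ (D.onBase_mul f x.2 _).symm
      rw [D.act_one]; rfl))
    (AlgHom.ext fun x => D.onBase_counit f x)
    (AlgHom.ext fun x => by
      refine Eq.trans ?_ (D.onBase_comul f x).symm
      rw [← D.neutral_comul x]
      change TensorProduct.map (D.onBase f ∘ₗ D.neutral.val.toLinearMap)
        (D.onBase f ∘ₗ D.neutral.val.toLinearMap) (comul (R := K) x) = _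
      rw [TensorProduct.map_comp]; rfl)

theorem onNeutral_surjective (h : D.image f 1 = ⊤) : Function.Surjective (D.onNeutral f) := by
  intro x
  have hx : x ∈ D.image f 1 := h ▸ Submodule.mem_top
  obtain ⟨a, ha, rfl⟩ := hx
  exact ⟨⟨a, ha⟩, rfl⟩

/-- A coalgebra map `A → L` that is multiplicative up to the action induces a homomorphism
`A^{t,α} → L`. -/
def twistHom (φ : A →ₗ[K] L) (h1 : φ 1 = 1)
    (hmul : ∀ g, ∀ a ∈ D.component g, ∀ b, φ (a * D.act g b) = φ a * φ b)
    (hcounit : ∀ a, counit (R := K) (φ a) = counit (R := K) a)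
    (hcomul : ∀ a, comul (R := K) (φ a) = TensorProduct.map φ φ (comul (R := K) a)) :
    D.twist →ₐc[K] L :=
  BialgHom.ofAlgHom
    (AlgHom.ofLinearMap (φ ∘ₗ D.j.symm.toLinearMap)
      (by
        rw [LinearMap.comp_apply, LinearEquiv.coe_coe, ← j_one, LinearEquiv.symm_apply_apply, h1])
      (by
        intro x y
        obtain ⟨b, rfl⟩ := D.j.surjective y
        refine D.twist_forall (P := fun x => (φ ∘ₗ D.j.symm.toLinearMap) (x * D.j b) =
          (φ ∘ₗ D.j.symm.toLinearMap) x * (φ ∘ₗ D.j.symm.toLinearMap) (D.j b)) x (by simp) ?_ ?_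
        · intro g a ha
          simp only [D.j_mul ha, LinearMap.comp_apply, LinearEquiv.coe_coe,
            LinearEquiv.symm_apply_apply, hmul g a ha]
        · intro x y hx hy
          rw [add_mul, map_add, map_add, hx, hy, add_mul]))
    (AlgHom.ext fun x => by
      obtain ⟨a, rfl⟩ := D.j.surjective x
      refine Eq.trans ?_ (D.twist_counit a).symm
      change counit (R := K) (φ (D.j.symm (D.j a))) = _
      rw [LinearEquiv.symm_apply_apply, hcounit])
    (AlgHom.ext fun x => by
      obtain ⟨a, rfl⟩ := D.j.surjective x
      change TensorProduct.map (φ ∘ₗ D.j.symm.toLinearMap) (φ ∘ₗ D.j.symm.toLinearMap)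
        (comul (R := K) (D.j a)) = comul (R := K) (φ (D.j.symm (D.j a)))
      have hj : (φ ∘ₗ D.j.symm.toLinearMap) ∘ₗ D.j.toLinearMap = φ := by ext; simp
      rw [LinearEquiv.symm_apply_apply, hcomul, twist_comul, ← LinearMap.comp_apply,
        ← TensorProduct.map_comp, hj])

end Ring

/-! ### The graded kernel and the twisting of the quotient by it. -/

section CommRing
variable [CommRing A] [HopfAlgebra K A] (D : InvariantCocentralAction K Γ A)
variable {L : Type*} [Ring L] [HopfAlgebra K L] (f : D.twist →ₐc[K] L)

theorem mk_mem_component (I : Ideal A) [I.IsHopfIdeal K] (hgr : D.IsGradedIdeal I)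
    (hst : D.IsStableIdeal I) {g : Γ} {a : A} (ha : a ∈ D.component g) :
    Ideal.Quotient.mk I a ∈ (D.quotient I hgr hst).component g := by
  have h1 : TensorProduct.map (D.p : A →ₗ[K] MonoidAlgebra K Γ) LinearMap.id
    (comul (R := K) a) = MonoidAlgebra.single g 1 ⊗ₜ[K] a := ha
  have h2 := congrArg (TensorProduct.map (LinearMap.id : MonoidAlgebra K Γ →ₗ[K] _)
    (Ideal.Quotient.mkₐ K I).toLinearMap) h1
  refine Eq.trans ?_ h2
  rw [Bialgebra.Quotient.comul_mk]
  generalize comul (R := K) a = t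
  induction t with
  | zero => simp
  | add x y hx hy => simp only [map_add, hx, hy]
  | tmul x y => rfl

theorem proj_mk (I : Ideal A) [I.IsHopfIdeal K] (hgr : D.IsGradedIdeal I)
    (hst : D.IsStableIdeal I) (g : Γ) (a : A) :
    (D.quotient I hgr hst).proj g (Ideal.Quotient.mk I a) = Ideal.Quotient.mk I (D.proj g a) := by
  refine D.component_induction (P := fun a => (D.quotient I hgr hst).proj g
    (Ideal.Quotient.mk I a) = Ideal.Quotient.mk I (D.proj g a)) a (by simp) ?_ ?_
  · intro h a ha
    by_cases hg : h = g
    · subst hg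
      rw [proj_eq_self _ (D.mk_mem_component I hgr hst ha), D.proj_eq_self ha]
    · rw [proj_eq_zero _ (D.mk_mem_component I hgr hst ha) hg, D.proj_eq_zero ha hg, map_zero]
  · intro x y hx hy
    simp only [map_add, hx, hy]

/-- The kernel of a homomorphism on the twisting, transported to an ideal of `A`, provided that it
is graded. -/
def kerIdeal [Finite Γ] (h : iSupIndep (D.image f)) : Ideal A where
  carrier := {a | D.onBase f a = 0}
  zero_mem' := map_zero _
  add_mem' {x y} hx hy := by
    simp only [Set.mem_ofPred_eq] at *
    rw [map_add, hx, hy, add_zero]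
  smul_mem' c a ha := by
    have := Fintype.ofFinite Γ
    simp only [Set.mem_ofPred_eq] at *
    -- Commutativity of `A` puts the kernel element on the left, where it splits into components
    -- `a_g`. Each satisfies `φ(a_g c) = φ(a_g) φ(α_{g⁻¹}(c)) = 0`.
    rw [smul_eq_mul, mul_comm, ← D.sum_proj a, Finset.sum_mul, map_sum]
    refine Finset.sum_eq_zero fun g _ => ?_
    have h1 := D.onBase_mul f (D.proj_mem g a) (D.act g⁻¹ c)
    rwa [D.onBase_proj_eq_zero f h ha, zero_mul, ← D.act_mul, mul_inv_cancel, D.act_one,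
      eq_comm] at h1

variable [Finite Γ] (h : iSupIndep (D.image f))

theorem mem_kerIdeal {a : A} : a ∈ D.kerIdeal f h ↔ D.onBase f a = 0 := Iff.rfl

theorem isGradedIdeal_kerIdeal : D.IsGradedIdeal (D.kerIdeal f h) := by
  have := Fintype.ofFinite Γ
  apply le_antisymm
  · intro a ha
    rw [← D.sum_proj a]
    exact Submodule.sum_mem _ fun g _ => Submodule.mem_iSup_of_mem g
      ⟨D.onBase_proj_eq_zero f h ha g, D.proj_mem g a⟩
  · exact iSup_le fun g => inf_le_left

/-- Choose `b ∈ A_g` with `ε(b) = 1`. Then `α_g(a) = S(b₁) b₂ α_g(a)`. Since `Δ(b) ∈ A_g ⊗ A_g`, one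
has `φ(b₂ α_g(a)) = φ(b₂) φ(a) = 0`, so each term lies in the ideal. -/
theorem isStableIdeal_kerIdeal (hp : Function.Surjective D.p) :
    D.IsStableIdeal (D.kerIdeal f h) := by
  intro g a ha
  obtain ⟨b, hb, hb1⟩ := D.exists_counit_eq_one hp g
  have e : ∀ t ∈ Submodule.span K
      {t : A ⊗[K] A | ∃ x ∈ D.component g, ∃ y ∈ D.component g, t = x ⊗ₜ[K] y},
      LinearMap.mul' K A ((antipode K).rTensor A t) * D.act g a ∈ D.kerIdeal f h := by
    intro t ht
    induction ht using Submodule.span_induction with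
    | zero => simp
    | add x y _ _ hx hy => simp only [map_add, add_mul]; exact add_mem hx hy
    | smul c x _ hx =>
      simp only [map_smul, smul_mul_assoc]
      exact ((D.kerIdeal f h).restrictScalars K).smul_mem c hx
    | mem x hx =>
      obtain ⟨x, hx, y, hy, rfl⟩ := hx
      simp only [LinearMap.rTensor_tmul, LinearMap.mul'_apply, mul_assoc]
      refine Ideal.mul_mem_left _ _ ?_
      rw [mem_kerIdeal] at ha ⊢
      rw [← D.onBase_mul f hy, ha, mul_zero]
  have := e _ (D.comul_mem_span hb)
  rwa [mul_antipode_rTensor_comul_apply, hb1, map_one, one_mul] at this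

/-- The embedding of the quotient by the kernel. -/
def quotientOnBase : (A ⧸ D.kerIdeal f h) →ₗ[K] L :=
  Submodule.liftQ ((D.kerIdeal f h).restrictScalars K) (D.onBase f) (fun _ ha => ha)

theorem quotientOnBase_mk (a : A) :
    D.quotientOnBase f h (Ideal.Quotient.mk _ a) = D.onBase f a := rfl

theorem quotientOnBase_injective : Function.Injective (D.quotientOnBase f h) := by
  rw [injective_iff_map_eq_zero]
  intro x hx
  obtain ⟨a, rfl⟩ := Ideal.Quotient.mk_surjective x
  exact Ideal.Quotient.eq_zero_iff_mem.2 hx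

theorem isHopfIdeal_kerIdeal (hp : Function.Surjective D.p) : (D.kerIdeal f h).IsHopfIdeal K where
  counit_eq_zero a ha := by
    rw [← D.onBase_counit f, (D.mem_kerIdeal f h).1 ha, map_zero]
  map_mkQ_comul_eq_zero a ha := by
    let q : (A ⧸ (D.kerIdeal f h).restrictScalars K) →ₗ[K] L :=
      Submodule.liftQ _ (D.onBase f) (fun _ ha => ha)
    have hq : Function.Injective q := D.quotientOnBase_injective f h
    have hqm : q ∘ₗ ((D.kerIdeal f h).restrictScalars K).mkQ = D.onBase f := rfl
    -- Over a field, `q ⊗ q` is injective along with `q : A ⧸ I → L`, so the coideal condition can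
    -- be checked in `L ⊗ L`.
    apply TensorProduct.map_injective_of_flat_flat q q hq hq
    rw [← LinearMap.comp_apply, ← TensorProduct.map_comp, hqm, ← D.onBase_comul,
      (D.mem_kerIdeal f h).1 ha, map_zero, map_zero]
  antipode_mem a ha := by
    have := Fintype.ofFinite Γ
    rw [← D.sum_proj a, map_sum]
    refine Ideal.sum_mem _ fun g _ => ?_
    -- This only yields `α_{g⁻¹}(S(a_g)) ∈ I`; stability under `α_g` then removes the twist.
    have h1 := D.antipode_onBase f (D.proj_mem g a)
    rw [D.onBase_proj_eq_zero f h ha, map_zero, eq_comm, ← D.mem_kerIdeal f h] at h1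
    have h2 := D.isStableIdeal_kerIdeal f h hp g _ h1
    rwa [← D.act_mul, mul_inv_cancel, D.act_one] at h2

/-- The twisting of the quotient by the graded kernel of `f` maps to the target of `f`. -/
def quotientTwistHom [(D.kerIdeal f h).IsHopfIdeal K] (hgr : D.IsGradedIdeal (D.kerIdeal f h))
    (hst : D.IsStableIdeal (D.kerIdeal f h)) :
    (D.quotient (D.kerIdeal f h) hgr hst).twist →ₐc[K] L :=
  (D.quotient (D.kerIdeal f h) hgr hst).twistHom (D.quotientOnBase f h) (D.onBase_one f)
    (by
      intro g x hx y
      obtain ⟨a, rfl⟩ := Ideal.Quotient.mk_surjective x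
      obtain ⟨b, rfl⟩ := Ideal.Quotient.mk_surjective y
      -- The lift `a` of the homogeneous class `x` need not be homogeneous, so it is replaced by its
      -- degree `g` part, to which `onBase_mul` applies.
      rw [← proj_eq_self _ hx, proj_mk]
      exact (D.onBase_mul f (D.proj_mem g a) b).symm)
    (by
      intro x
      obtain ⟨a, rfl⟩ := Ideal.Quotient.mk_surjective x
      exact D.onBase_counit f a)
    (by
      intro x
      obtain ⟨a, rfl⟩ := Ideal.Quotient.mk_surjective x
      rw [quotientOnBase_mk, onBase_comul, Bialgebra.Quotient.comul_mk]
      exact (LinearMap.congr_fun (TensorProduct.map_comp (D.quotientOnBase f h)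
        (D.quotientOnBase f h) (Ideal.Quotient.mkₐ K (D.kerIdeal f h)).toLinearMap
        (Ideal.Quotient.mkₐ K (D.kerIdeal f h)).toLinearMap) (comul (R := K) a)))

/-- The map is the inverse of `j` for the quotient followed by the injection `A ⧸ I → L` induced by
`φ`, whose image is that of `f`. -/
theorem quotientTwistHom_bijective [(D.kerIdeal f h).IsHopfIdeal K]
    (hgr : D.IsGradedIdeal (D.kerIdeal f h)) (hst : D.IsStableIdeal (D.kerIdeal f h))
    (hf : Function.Surjective f) : Function.Bijective (D.quotientTwistHom f h hgr hst) := by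
  refine ⟨(D.quotientOnBase_injective f h).comp (LinearEquiv.injective _), ?_⟩
  refine Function.Surjective.comp (g := D.quotientOnBase f h) ?_ (LinearEquiv.surjective _)
  intro x
  obtain ⟨y, rfl⟩ := hf x
  obtain ⟨a, rfl⟩ := D.j.surjective y
  exact ⟨Ideal.Quotient.mk _ a, rfl⟩

end CommRing
end
end InvariantCocentralAction

/-! ### The dichotomy for groups of prime order. -/

theorem mainTheorem5 {K : Type*} [Field K] [CharZero K]
    {Γ : Type*} [Group Γ] [IsCyclic Γ] (hΓ : (Nat.card Γ).Prime)
    {A : Type*} [CommRing A] [HopfAlgebra K A]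
    (D : InvariantCocentralAction K Γ A) (hp : Function.Surjective D.p)
    {L : Type*} [Ring L] [HopfAlgebra K L]
    (f : D.twist →ₐc[K] L) (hf : Function.Surjective f) :
    ((∀ x y : L, x * y = y * x) ∧ ∃ q : D.neutral →ₐc[K] L, Function.Surjective q) ∨
    ∃ (I : Ideal A) (_ : I.IsHopfIdeal K) (hgr : D.IsGradedIdeal I) (hst : D.IsStableIdeal I),
      Nonempty (L ≃ₐc[K] (D.quotient I hgr hst).twist) := by
  have : Finite Γ := Nat.finite_of_card_ne_zero hΓ.ne_zero
  have : Fact (Nat.card Γ).Prime := ⟨hΓ⟩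
  -- Trivial `unitDegrees` means the images are independent and gives case (ii); the full group
  -- means they all collapse into `C_e` and gives case (i).
  rcases (D.unitDegrees f).eq_bot_or_eq_top_of_prime_card with hbot | htop
  · right
    have h : iSupIndep (D.image f) := by
      refine Submodule.IsSubcoalgebra.iSupIndep (D.isSubcoalgebra_image f) fun g h hgh => ?_
      by_contra hdis
      have h1 : g * h⁻¹ ∈ D.unitDegrees f := D.one_mem_image_of_not_disjoint f hdis
      rw [hbot, Subgroup.mem_bot] at h1
      exact hgh (mul_inv_eq_one.1 h1)
    have hI := D.isHopfIdeal_kerIdeal f h hp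
    exact ⟨D.kerIdeal f h, hI, D.isGradedIdeal_kerIdeal f h, D.isStableIdeal_kerIdeal f h hp,
      ⟨(BialgEquiv.ofBijective (D.quotientTwistHom f h _ _)
        (D.quotientTwistHom_bijective f h _ _ hf)).symm⟩⟩
  · left
    have hs := D.onNeutral_surjective f (D.image_one_eq_top f hf htop)
    refine ⟨fun x y => ?_, D.onNeutral f, hs⟩
    obtain ⟨a, rfl⟩ := hs x
    obtain ⟨b, rfl⟩ := hs y
    rw [← map_mul, ← map_mul, mul_comm]
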